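/- Let $G$ be a group, and let subgroups $H,K\le G$ be given. Say that $H$ \emph{virtually contains} $K$ if $H$ contains a finite index subgroup of $K$, and that $H$ and $K$ are \emph{commensurate} if each virtually contains the other; $H$ is \emph{commensurated} in $G$ if it is commensurate with all of its $G$-conjugates. A \emph{$BN$-pair} in $G$ is a pair $(B,N)$ of subgroups such that $G=\langle B,N\rangle$, $T:=B\cap N$ is normal in $N$, and $W=N/T$ (the \emph{Weyl group}) has a generating set $S$ with $s^2=1$ for all $s\in S$ such that (i) $BwB\cdot BsB\subseteq BwB\cup BwsB$ for all $s\in S$, $w\in W$, and (ii) $sBs^{-1}\not\subseteq B$ for all $s\in S$. For $J\subseteq S$ let $W_J=\langle J\rangle\le W$ and let $P_J=BW_JB\le G$ be the corresponding standard parabolic subgroups. Let $\Lambda^f_{(W,S)}$ be the poset of standard parabolic subgroups $W_J$ $(J\subseteq S)$ of $W$ up to finite index: its elements are the commensurability classes $[W_J]$, and $[W_J]\le[W_{J'}]$ means that $W_J$ is virtually contained in $W_{J'}$. \textbf{Theorem.} Let $G$ be a group with a $BN$-pair $(B,N)$ with Weyl group $(W,S)$, such that $B$ is a commensurated subgroup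 of $G$ and $S$ is finite, and let $J,J'\subseteq S$. (a) Let $g\in G$ be such that $gP_Jg^{-1}$ is virtually contained in $P_{J'}$. Then $[W_J]\le[W_{J'}]$ in $\Lambda^f_{(W,S)}$, and $[W_J]=[W_{J'}]$ if and only if $gP_Jg^{-1}$ is commensurate with $P_{J'}$. (b) Conversely, if $[W_J]\le[W_{J'}]$, then $P_J$ is virtually contained in $P_{J'}$. -/

import Mathlib

open scoped Pointwise

namespace BNPairs

section Virtual

/-- `H` virtually contains `K`: `H` contains a finite index subgroup of `K`. -/
def VirtuallyContains {G : Type*} [Group G] (H K : Subgroup G) : Prop :=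
  ∃ L : Subgroup G, L ≤ H ∧ L ≤ K ∧ (L.subgroupOf K).FiniteIndex

theorem virtuallyContains_iff {G : Type*} [Group G] {H K : Subgroup G} :
    VirtuallyContains H K ↔ H.relIndex K ≠ 0 := by
  constructor
  · rintro ⟨L, hLH, -, hL⟩ h0
    exact hL.index_ne_zero (Subgroup.relIndex_eq_zero_of_le_left hLH h0)
  · intro h
    refine ⟨H ⊓ K, inf_le_left, inf_le_right, ⟨?_⟩⟩
    rw [← Subgroup.relIndex, Subgroup.inf_relIndex_right]
    exact h

/-- Mathlib's relation `Subgroup.Commensurable` says that each subgroup virtually contains the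
other. -/
theorem commensurable_iff {G : Type*} [Group G] {H K : Subgroup G} :
    H.Commensurable K ↔ VirtuallyContains H K ∧ VirtuallyContains K H := by
  rw [virtuallyContains_iff, virtuallyContains_iff]; rfl

/-- `H` is commensurated in `G`: it is commensurate with all of its conjugates. -/
def IsCommensurated {G : Type*} [Group G] (H : Subgroup G) : Prop :=
  ∀ g : G, (MulAut.conj g • H).Commensurable H

end Virtual

section StandardParabolics

/-- The standard parabolic subgroups `W_J = ⟨J⟩`, `J ⊆ S`, of a group `W` with a distinguished
generating set `S`. -/
def StandardParabolic {W : Type*} [Group W] (S : Set W) : Type _ :=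
  {H : Subgroup W // ∃ J : Set W, J ⊆ S ∧ H = Subgroup.closure J}

/-- Commensurability, as an equivalence relation on the standard parabolic subgroups. -/
def commensurabilitySetoid {W : Type*} [Group W] (S : Set W) : Setoid (StandardParabolic S) where
  r H K := H.1.Commensurable K.1
  iseqv := ⟨fun _ => Subgroup.Commensurable.refl _, fun h => h.symm, fun h k => h.trans k⟩

/-- The set of standard parabolic subgroups up to finite index. -/
def ParabolicClass {W : Type*} [Group W] (S : Set W) : Type _ :=
  Quotient (commensurabilitySetoid S)

/-- The order is inclusion up to finite index: `[H] ≤ [K]` when `H` is virtually contained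
in `K`. -/
instance {W : Type*} [Group W] (S : Set W) : PartialOrder (ParabolicClass S) where
  le := Quotient.lift₂ (fun H K => VirtuallyContains K.1 H.1) (by
    intro H K H' K' hH hK
    simp only [virtuallyContains_iff, eq_iff_iff]
    exact ⟨fun h => Subgroup.relIndex_ne_zero_trans hK.2
        (Subgroup.relIndex_ne_zero_trans h hH.1),
      fun h => Subgroup.relIndex_ne_zero_trans hK.1
        (Subgroup.relIndex_ne_zero_trans h hH.2)⟩)
  le_refl := by
    rintro ⟨H⟩
    exact (commensurable_iff.1 (Subgroup.Commensurable.refl H.1)).1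
  le_trans := by
    rintro ⟨H⟩ ⟨K⟩ ⟨L⟩ h k
    exact virtuallyContains_iff.2 (Subgroup.relIndex_ne_zero_trans
      (virtuallyContains_iff.1 k) (virtuallyContains_iff.1 h))
  le_antisymm := by
    rintro ⟨H⟩ ⟨K⟩ h k
    exact Quotient.sound (commensurable_iff.2 ⟨k, h⟩)

/-- The class `[W_J]` of the standard parabolic subgroup `W_J = ⟨J⟩`. -/
def parabolicClass {W : Type*} [Group W] {S J : Set W} (hJ : J ⊆ S) : ParabolicClass S :=
  Quotient.mk (commensurabilitySetoid S) ⟨Subgroup.closure J, J, hJ, rfl⟩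

theorem parabolicClass_le_iff {W : Type*} [Group W] {S J J' : Set W} (hJ : J ⊆ S)
    (hJ' : J' ⊆ S) : parabolicClass hJ ≤ parabolicClass hJ' ↔
      VirtuallyContains (Subgroup.closure J') (Subgroup.closure J) := Iff.rfl

end StandardParabolics

/-- For `T = B ∩ N` and `w ∈ N / T`, the double coset `B w B`. -/
def doubleCoset {G : Type*} [Group G] (B N : Subgroup G) (w : N ⧸ B.subgroupOf N) : Set G :=
  {x | ∃ b ∈ B, ∃ n : N, (n : N ⧸ B.subgroupOf N) = w ∧ ∃ b' ∈ B, x = b * n * b'}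

/-- A `BN`-pair `(B, N)` in `G`, together with the generating set `S` (which is determined by
`B` and `N`) of the Weyl group `W = N / (B ∩ N)`. -/
structure BNPair (G : Type*) [Group G] where
  B : Subgroup G
  N : Subgroup G
  sup_eq_top : B ⊔ N = ⊤
  [normal : (B.subgroupOf N).Normal]
  S : Set (N ⧸ B.subgroupOf N)
  closure_S : Subgroup.closure S = ⊤
  mul_self : ∀ s ∈ S, s * s = 1
  mul_subset : ∀ s ∈ S, ∀ w : N ⧸ B.subgroupOf N,
    doubleCoset B N w * doubleCoset B N s ⊆ doubleCoset B N w ∪ doubleCoset B N (w * s)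
  not_conj_le : ∀ n : N, (n : N ⧸ B.subgroupOf N) ∈ S → ¬ MulAut.conj (n : G) • B ≤ B

namespace BNPair

attribute [instance] BNPair.normal

/-- The Weyl group `N / (B ∩ N)`. -/
abbrev Weyl {G : Type*} [Group G] (P : BNPair G) : Type _ := P.N ⧸ P.B.subgroupOf P.N

theorem mul_mem_aux {G : Type*} [Group G] (P : BNPair G) {J : Set P.Weyl} (hJ : J ⊆ P.S)
    {w v : P.Weyl} (hw : w ∈ Subgroup.closure J) (hv : v ∈ Subgroup.closure J) {x y : G}
    (hx : x ∈ doubleCoset P.B P.N w) (hy : y ∈ doubleCoset P.B P.N v) :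
    ∃ u ∈ Subgroup.closure J, x * y ∈ doubleCoset P.B P.N u := by
  have step : ∀ (v : P.Weyl), ∀ s ∈ J,
      (∀ y ∈ doubleCoset P.B P.N v, ∃ u ∈ Subgroup.closure J, x * y ∈ doubleCoset P.B P.N u) →
      ∀ y ∈ doubleCoset P.B P.N (v * s),
        ∃ u ∈ Subgroup.closure J, x * y ∈ doubleCoset P.B P.N u := by
    rintro v s hs ih y ⟨b, hb, n, hn, b', hb', rfl⟩
    obtain ⟨m, rfl⟩ := QuotientGroup.mk_surjective s
    obtain ⟨u, hu, hxu⟩ := ih (b * (n * m⁻¹ : P.N) * 1)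
      ⟨b, hb, n * m⁻¹, by rw [QuotientGroup.mk_mul, hn, QuotientGroup.mk_inv,
        mul_inv_cancel_right], 1, P.B.one_mem, rfl⟩
    have hm : (m * b' : G) ∈ doubleCoset P.B P.N (m : P.Weyl) :=
      ⟨1, P.B.one_mem, m, rfl, b', hb', by simp⟩
    have := P.mul_subset _ (hJ hs) u (Set.mul_mem_mul hxu hm)
    have e : x * (b * (n * m⁻¹ : P.N) * 1) * (m * b') = x * (b * n * b') := by
      simp [mul_assoc]
    rw [e] at this
    rcases this with h | h
    · exact ⟨_, hu, h⟩
    · exact ⟨_, mul_mem hu (Subgroup.subset_closure hs), h⟩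
  induction hv using Subgroup.closure_induction_right generalizing y with
  | one =>
    obtain ⟨b, hb, n, hn, b', hb', rfl⟩ := hx
    obtain ⟨c, hc, m, hm, c', hc', rfl⟩ := hy
    have hm' : (m : G) ∈ P.B := by
      rw [QuotientGroup.eq_one_iff, Subgroup.mem_subgroupOf] at hm
      exact hm
    exact ⟨w, hw, b, hb, n, hn, b' * (c * m * c'),
      mul_mem hb' (mul_mem (mul_mem hc hm') hc'), by simp [mul_assoc]⟩
  | mul_right v hv s hs ih => exact step v s hs (fun y hy => ih hy) y hy
  | mul_inv_cancel v hv s hs ih =>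
    rw [inv_eq_of_mul_eq_one_right (P.mul_self s (hJ hs))] at hy
    exact step v s hs (fun y hy => ih hy) y hy

/-- The standard parabolic subgroup `P_J = B W_J B`, the union of the double cosets `B w B`
with `w ∈ W_J = ⟨J⟩`. -/
def parabolic {G : Type*} [Group G] (P : BNPair G) (J : Set P.Weyl) (hJ : J ⊆ P.S) :
    Subgroup G where
  carrier := {x | ∃ w ∈ Subgroup.closure J, x ∈ doubleCoset P.B P.N w}
  one_mem' := ⟨1, one_mem _, 1, one_mem _, 1, rfl, 1, one_mem _, by simp⟩
  mul_mem' := by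
    rintro x y ⟨w, hw, hx⟩ ⟨v, hv, hy⟩
    exact P.mul_mem_aux hJ hw hv hx hy
  inv_mem' := by
    rintro x ⟨w, hw, b, hb, n, rfl, b', hb', rfl⟩
    exact ⟨(n : P.Weyl)⁻¹, inv_mem hw, b'⁻¹, inv_mem hb', n⁻¹, rfl, b⁻¹, inv_mem hb,
      by simp [mul_assoc]⟩

end BNPair

end BNPairs

open scoped Pointwise

/-!
Virtual containment of `K` in `H` means that finitely many left cosets of `H` cover `K`
(`relIndex_ne_zero_iff_exists_cover`). Because `B` is commensurated, a cell `B w B` is a finite union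
of left cosets of `B`, so a finite cover of `W_J` by cosets of `W_J'` gives a finite cover of
`P_J` by cosets of `P_J'` (`parabolic_relIndex_ne_zero`). In the other direction, the product of a
fixed cell with a variable one meets boundedly many translates of the latter
(`exists_finite_forall_mul_mem_cell`), so if `n P_J n⁻¹` is virtually contained in `P_J'`, then
`v W_J v⁻¹` is virtually contained in `W_J'`, where `v` is the class of `n`. By the Bruhat
decomposition it suffices to treat conjugating elements `n ∈ N`.

It remains to remove the conjugation by `v`, inside `W`. The Weyl group satisfies the exchange
condition (`BNPair.hasExchange`), which is all that is used about it. A set of letters `I` is called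
essential if no proper subset generates a subgroup of finite index in `W_I`; every finite `J`
contains an essential `I` with `W_I` of finite index in `W_J`. Suppose that `W_I` is virtually
contained in a conjugate of `W_J'`, and let `d` be a representative of minimal length of the double
coset in question. Then `d⁻¹ I d ⊆ J'`, by Kilmoyer's theorem and essentiality. If `t` is a first
letter of `d`, all the conjugates `w t w⁻¹` with `w ∈ W_I` have the form `d' d⁻¹`, where `d'` arises
from a fixed reduced word for `d` by omission of a letter. So there are finitely many of them, the
centralizer of `t` in `W_I` has finite index, and `t` commutes with `I` by essentiality. Inductively,
`d` is a product of letters that commute with `I` (`HasExchange.mem_closure_perp`), whence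
`I ⊆ J'`, so that `W_J` is virtually contained in `W_J'`.

The same description of `d` settles the case of equality: a letter that commutes with `I` is
represented by elements that conjugate `P_I` to a commensurate subgroup, so `P_I` is commensurate
with every conjugate of `P_I` that it virtually contains (`conj_parabolic_relIndex_ne_zero`).
-/

namespace BNPairs

/-! ### Virtual containment as a covering property -/

section Cover

variable {G : Type*} [Group G]

theorem relIndex_ne_zero_of_finite_image {α : Type*} {H K : Subgroup G} (f : G → α)
    (hf : (f '' K).Finite) (h : ∀ x ∈ K, ∀ y ∈ K, f x = f y → x⁻¹ * y ∈ H) :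
    H.relIndex K ≠ 0 := by
  have : Finite (f '' (K : Set G)) := hf
  have : Finite (K ⧸ H.subgroupOf K) := by
    refine Finite.of_injective
      (fun q => (⟨f (q.out : K), (q.out : K), (q.out : K).2, rfl⟩ : f '' (K : Set G))) ?_
    intro p q hpq
    have h1 := h _ (p.out : K).2 _ (q.out : K).2 (congrArg Subtype.val hpq)
    rw [← p.out_eq', ← q.out_eq']
    exact QuotientGroup.eq.2 h1
  exact Subgroup.index_ne_zero_of_finite

/-- `H` virtually contains `K` exactly when finitely many left cosets of `H` cover `K`. The
representatives need not lie in `K`, which makes the criterion usable for double cosets. -/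
theorem relIndex_ne_zero_iff_exists_cover {H K : Subgroup G} :
    H.relIndex K ≠ 0 ↔ ∃ F : Set G, F.Finite ∧ (K : Set G) ⊆ F * (H : Set G) := by
  constructor
  · intro h
    have : (H.subgroupOf K).FiniteIndex := ⟨h⟩
    have : Finite (K ⧸ H.subgroupOf K) := Subgroup.finite_quotient_of_finiteIndex
    refine ⟨Set.range fun q : K ⧸ H.subgroupOf K => ((q.out : K) : G), Set.finite_range _, ?_⟩
    intro k hk
    refine Set.mem_mul.2 ⟨_, ⟨(⟨k, hk⟩ : K), rfl⟩,
      (((⟨k, hk⟩ : K) : K ⧸ H.subgroupOf K).out : G)⁻¹ * k, ?_, by simp⟩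
    have := QuotientGroup.eq.1 ((⟨k, hk⟩ : K) : K ⧸ H.subgroupOf K).out_eq'
    exact this
  · rintro ⟨F, hF, hK⟩
    choose! f hfF hf using fun (x : G) (hx : x ∈ K) => Set.mem_mul.1 (hK hx)
    refine relIndex_ne_zero_of_finite_image f (hF.subset ?_) ?_
    · rintro _ ⟨x, hx, rfl⟩
      exact hfF x hx
    · intro x hx y hy hxy
      obtain ⟨a, ha, hax⟩ := hf x hx
      obtain ⟨b, hb, hby⟩ := hf y hy
      rw [← hax, ← hby, hxy]
      simpa [mul_assoc] using mul_mem (inv_mem ha) hb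

theorem mem_conj_smul {H : Subgroup G} {g x : G} :
    x ∈ MulAut.conj g • H ↔ g⁻¹ * x * g ∈ H := by
  rw [Subgroup.mem_pointwise_smul_iff_inv_smul_mem, ← map_inv, MulAut.smul_def,
    MulAut.conj_apply, inv_inv]

theorem relIndex_conj_smul_right {H K : Subgroup G} (g : G) :
    H.relIndex (MulAut.conj g • K) = (MulAut.conj g⁻¹ • H).relIndex K := by
  rw [← Subgroup.relIndex_pointwise_smul (MulAut.conj g) (MulAut.conj g⁻¹ • H) K, smul_smul,
    ← map_mul, mul_inv_cancel, map_one, one_smul]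

end Cover

/-! ### Word length and the exchange condition -/

section Exchange

variable {W : Type*} [Group W]

/-- The least length of a word in the letters `S` with product `w`; it is the junk value `0` when
there is no such word, which does not occur for a generating set of involutions. -/
noncomputable def wordLength (S : Set W) (w : W) : ℕ :=
  sInf {n | ∃ ω : List W, (∀ x ∈ ω, x ∈ S) ∧ ω.prod = w ∧ ω.length = n}

/-- `S` is a generating set of involutions of `W` that satisfies the exchange condition:
if left multiplication by `s ∈ S` does not increase the length of the product of a word in `S`,
then it amounts to the omission of a letter of that word. The word need not be reduced. -/
structure HasExchange (S : Set W) : Prop where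
  closure_eq : Subgroup.closure S = ⊤
  mul_self : ∀ s ∈ S, s * s = 1
  exchange : ∀ s ∈ S, ∀ ω : List W, (∀ x ∈ ω, x ∈ S) →
    wordLength S (s * ω.prod) ≤ wordLength S ω.prod →
      ∃ ω' : List W, ω'.Sublist ω ∧ ω'.length + 1 = ω.length ∧ s * ω.prod = ω'.prod

theorem prod_mem_closure {J : Set W} {ω : List W} (h : ∀ x ∈ ω, x ∈ J) :
    ω.prod ∈ Subgroup.closure J :=
  Subgroup.list_prod_mem _ fun x hx => Subgroup.subset_closure (h x hx)

theorem wordLength_prod_le {S : Set W} {ω : List W} (h : ∀ x ∈ ω, x ∈ S) :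
    wordLength S ω.prod ≤ ω.length :=
  Nat.sInf_le ⟨ω, h, rfl, rfl⟩

theorem inv_eq_self_of_mul_self {S : Set W} (h2 : ∀ s ∈ S, s * s = 1) {s : W} (hs : s ∈ S) :
    s⁻¹ = s :=
  inv_eq_of_mul_eq_one_right (h2 s hs)

/-- Induction by left multiplication with letters, for a set of involutions. -/
@[elab_as_elim]
theorem closure_induction_of_involutions {J : Set W} (h2 : ∀ s ∈ J, s * s = 1) {p : W → Prop}
    (one : p 1) (mul : ∀ s ∈ J, ∀ w ∈ Subgroup.closure J, p w → p (s * w)) {w : W}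
    (hw : w ∈ Subgroup.closure J) : p w := by
  induction hw using Subgroup.closure_induction_left with
  | one => exact one
  | mul_left s hs w hw ih => exact mul s hs w hw ih
  | inv_mul_cancel s hs w hw ih =>
    rw [inv_eq_self_of_mul_self h2 hs]
    exact mul s hs w hw ih

theorem exists_word_of_involutions {S : Set W} (hcl : Subgroup.closure S = ⊤)
    (h2 : ∀ s ∈ S, s * s = 1) (w : W) :
    ∃ ω : List W, (∀ x ∈ ω, x ∈ S) ∧ ω.prod = w ∧ ω.length = wordLength S w := by
  have hw : w ∈ Subgroup.closure S := by rw [hcl]; trivial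
  have : {n | ∃ ω : List W, (∀ x ∈ ω, x ∈ S) ∧ ω.prod = w ∧ ω.length = n}.Nonempty := by
    refine closure_induction_of_involutions h2 ?_ ?_ hw
    · exact ⟨0, [], by simp⟩
    · rintro s hs _ - ⟨_, ω, hω, rfl, rfl⟩
      exact ⟨_, s :: ω, by simpa using ⟨hs, hω⟩, by simp, rfl⟩
  exact Nat.sInf_mem this

theorem wordLength_mul_le_of_involutions {S : Set W} (hcl : Subgroup.closure S = ⊤)
    (h2 : ∀ s ∈ S, s * s = 1) (v w : W) :
    wordLength S (v * w) ≤ wordLength S v + wordLength S w := by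
  obtain ⟨ω, hω, rfl, hl⟩ := exists_word_of_involutions hcl h2 v
  obtain ⟨δ, hδ, rfl, hl'⟩ := exists_word_of_involutions hcl h2 w
  rw [← hl, ← hl', ← List.prod_append, ← List.length_append]
  refine wordLength_prod_le fun x hx => ?_
  rcases List.mem_append.1 hx with h | h
  exacts [hω x h, hδ x h]

namespace HasExchange

variable {S J J' : Set W}

theorem exists_word (hS : HasExchange S) (w : W) :
    ∃ ω : List W, (∀ x ∈ ω, x ∈ S) ∧ ω.prod = w ∧ ω.length = wordLength S w :=
  exists_word_of_involutions hS.closure_eq hS.mul_self w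

theorem wordLength_one : wordLength S (1 : W) = 0 :=
  Nat.le_zero.1 (wordLength_prod_le (ω := []) (by simp))

theorem eq_one_of_wordLength (hS : HasExchange S) {w : W} (h : wordLength S w = 0) : w = 1 := by
  obtain ⟨ω, -, rfl, hl⟩ := hS.exists_word w
  rw [h, List.length_eq_zero_iff] at hl
  simp [hl]

theorem wordLength_mul_le (hS : HasExchange S) (v w : W) :
    wordLength S (v * w) ≤ wordLength S v + wordLength S w :=
  wordLength_mul_le_of_involutions hS.closure_eq hS.mul_self v w

theorem wordLength_inv_le (hS : HasExchange S) (w : W) :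
    wordLength S w⁻¹ ≤ wordLength S w := by
  obtain ⟨ω, hω, rfl, hl⟩ := hS.exists_word w
  have e : ω.map (·⁻¹) = ω := by
    conv_rhs => rw [← List.map_id ω]
    exact List.map_congr_left fun x hx => inv_eq_self_of_mul_self hS.mul_self (hω x hx)
  rw [List.prod_inv_reverse, e, ← hl, ← List.length_reverse]
  exact wordLength_prod_le fun x hx => hω x (List.mem_reverse.1 hx)

theorem wordLength_inv (hS : HasExchange S) (w : W) : wordLength S w⁻¹ = wordLength S w :=
  le_antisymm (hS.wordLength_inv_le w) (by simpa using hS.wordLength_inv_le w⁻¹)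

theorem one_notMem (hS : HasExchange S) : (1 : W) ∉ S := fun h => by
  obtain ⟨ω, -, hl, -⟩ := hS.exchange 1 h [] (by simp) (by simp)
  simp at hl

theorem wordLength_of_mem (hS : HasExchange S) {s : W} (hs : s ∈ S) : wordLength S s = 1 := by
  have h1 : wordLength S s ≤ 1 := by
    simpa using wordLength_prod_le (S := S) (ω := [s]) (by simpa using hs)
  have h0 : wordLength S s ≠ 0 := fun h =>
    hS.one_notMem (hS.eq_one_of_wordLength h ▸ hs)
  omega

theorem mem_of_wordLength (hS : HasExchange S) {s : W} (h : wordLength S s = 1) : s ∈ S := by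
  obtain ⟨ω, hω, rfl, hl⟩ := hS.exists_word s
  rw [h, List.length_eq_one_iff] at hl
  obtain ⟨a, rfl⟩ := hl
  simpa using hω

theorem wordLength_le_letter_mul (hS : HasExchange S) {s : W} (hs : s ∈ S) (w : W) :
    wordLength S w ≤ wordLength S (s * w) + 1 := by
  have h := hS.wordLength_mul_le s (s * w)
  rw [← mul_assoc, hS.mul_self s hs, one_mul, hS.wordLength_of_mem hs] at h
  omega

theorem wordLength_letter_mul_le (hS : HasExchange S) {s : W} (hs : s ∈ S) (w : W) :
    wordLength S (s * w) ≤ wordLength S w + 1 := by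
  have h := hS.wordLength_mul_le s w
  rw [hS.wordLength_of_mem hs] at h
  omega

/-- The exchange condition for a concatenation: the omitted letter lies in one of the parts. -/
theorem exchange_mul (hS : HasExchange S) {s : W} (hs : s ∈ S) {ω δ : List W}
    (hω : ∀ x ∈ ω, x ∈ S) (hδ : ∀ x ∈ δ, x ∈ S)
    (h : wordLength S (s * (ω.prod * δ.prod)) ≤ wordLength S (ω.prod * δ.prod)) :
    (∃ ω' : List W, ω'.Sublist ω ∧ ω'.length + 1 = ω.length ∧ s * ω.prod = ω'.prod) ∨
      ∃ δ' : List W, δ'.Sublist δ ∧ δ'.length + 1 = δ.length ∧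
        s * ω.prod * δ.prod = ω.prod * δ'.prod := by
  rw [← List.prod_append] at h
  obtain ⟨ν, hν, hl, hp⟩ := hS.exchange s hs (ω ++ δ)
    (fun x hx => (List.mem_append.1 hx).elim (hω x) (hδ x)) h
  obtain ⟨a, b, rfl, ha, hb⟩ := List.sublist_append_iff.1 hν
  rw [List.length_append, List.length_append] at hl
  rw [List.prod_append, List.prod_append] at hp
  have ha' := ha.length_le
  have hb' := hb.length_le
  rcases Nat.lt_or_ge a.length ω.length with hlt | hge
  · have : b = δ := hb.eq_of_length (by omega)
    subst this
    exact .inl ⟨a, ha, by omega, mul_right_cancel (b := b.prod) (by rw [← hp, mul_assoc])⟩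
  · have : a = ω := ha.eq_of_length_le hge
    subst this
    exact .inr ⟨b, hb, by omega, by rw [← hp, mul_assoc]⟩

/-- An element of a standard parabolic subgroup `⟨J⟩` has a reduced word in the letters `J`. -/
theorem exists_word_of_mem_closure (hS : HasExchange S) (hJ : J ⊆ S) {w : W}
    (hw : w ∈ Subgroup.closure J) :
    ∃ ω : List W, (∀ x ∈ ω, x ∈ J) ∧ ω.prod = w ∧ ω.length = wordLength S w := by
  refine closure_induction_of_involutions (J := J) (fun s hs => hS.mul_self s (hJ hs)) ?_ ?_ hw
  · exact ⟨[], by simp [wordLength_one]⟩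
  · rintro s hs _ - ⟨ω, hω, rfl, hl⟩
    have h1 := hS.wordLength_le_letter_mul (hJ hs) ω.prod
    have h2 := hS.wordLength_letter_mul_le (hJ hs) ω.prod
    rcases Nat.lt_or_ge (wordLength S ω.prod) (wordLength S (s * ω.prod)) with h | h
    · exact ⟨s :: ω, by simpa using ⟨hs, hω⟩, by simp, by rw [List.length_cons]; omega⟩
    · obtain ⟨ω', hsub, hl', hp⟩ := hS.exchange s (hJ hs) ω (fun x hx => hJ (hω x hx)) h
      refine ⟨ω', fun x hx => hω x (hsub.subset hx), hp.symm, ?_⟩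
      have := wordLength_prod_le (S := S) (ω := ω') fun x hx => hJ (hω x (hsub.subset hx))
      rw [← hp] at this
      omega

theorem mem_of_mem_closure (hS : HasExchange S) (hJ : J ⊆ S) {s : W} (hs : s ∈ S)
    (h : s ∈ Subgroup.closure J) : s ∈ J := by
  obtain ⟨ω, hω, rfl, hl⟩ := hS.exists_word_of_mem_closure hJ h
  rw [hS.wordLength_of_mem hs, List.length_eq_one_iff] at hl
  obtain ⟨a, rfl⟩ := hl
  simpa using hω

/-- Lengths add up on a coset `⟨J⟩ d` whose representative `d` has minimal length. -/
theorem wordLength_mul_of_minimal (hS : HasExchange S) (hJ : J ⊆ S) {d : W}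
    (hd : ∀ x ∈ Subgroup.closure J, wordLength S d ≤ wordLength S (x * d)) {x : W}
    (hx : x ∈ Subgroup.closure J) : wordLength S (x * d) = wordLength S x + wordLength S d := by
  obtain ⟨δ, hδ, rfl, hδl⟩ := hS.exists_word d
  obtain ⟨ω, hω, rfl, hl⟩ := hS.exists_word_of_mem_closure hJ hx
  clear hx
  induction ω with
  | nil => simp [wordLength_one]
  | cons s ω ih =>
    have hsJ : s ∈ J := hω s (by simp)
    have hωJ : ∀ x ∈ ω, x ∈ J := fun x hx => hω x (by simp [hx])
    have hs := hJ hsJ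
    have hωS : ∀ x ∈ ω, x ∈ S := fun x hx => hJ (hωJ x hx)
    rw [List.prod_cons, List.length_cons] at hl
    rw [List.prod_cons]
    have h1 := hS.wordLength_letter_mul_le hs ω.prod
    have h2 := wordLength_prod_le hωS
    have ih := ih hωJ (by omega)
    have h3 := hS.wordLength_letter_mul_le hs (ω.prod * δ.prod)
    rcases Nat.lt_or_ge (wordLength S (ω.prod * δ.prod))
      (wordLength S (s * (ω.prod * δ.prod))) with h | h
    · rw [mul_assoc]; omega
    · exfalso
      rcases hS.exchange_mul hs hωS hδ h with ⟨ω', hsub, hl', hp⟩ | ⟨δ', hsub, hl', hp⟩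
      · have := wordLength_prod_le (S := S) (ω := ω') fun x hx => hωS x (hsub.subset hx)
        rw [← hp] at this
        omega
      · have h4 := wordLength_prod_le (S := S) (ω := δ') fun x hx => hδ x (hsub.subset hx)
        have h5 := hd (ω.prod⁻¹ * (s * ω.prod)) (mul_mem (inv_mem (prod_mem_closure hωJ))
          (mul_mem (Subgroup.subset_closure hsJ) (prod_mem_closure hωJ)))
        rw [mul_assoc, hp, inv_mul_cancel_left] at h5
        omega

theorem wordLength_mul_of_minimal_right (hS : HasExchange S) (hJ : J ⊆ S) {d : W}
    (hd : ∀ x ∈ Subgroup.closure J, wordLength S d ≤ wordLength S (d * x)) {x : W}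
    (hx : x ∈ Subgroup.closure J) : wordLength S (d * x) = wordLength S d + wordLength S x := by
  have := hS.wordLength_mul_of_minimal hJ (d := d⁻¹) (fun y hy => by
    rw [hS.wordLength_inv, ← hS.wordLength_inv (y * d⁻¹), mul_inv_rev, inv_inv]
    exact hd _ (inv_mem hy)) (inv_mem hx)
  rwa [← mul_inv_rev, hS.wordLength_inv, hS.wordLength_inv, hS.wordLength_inv, add_comm] at this

/-- Kilmoyer's theorem: for a double coset representative `d` of minimal length, the
intersection of `⟨J⟩` with `d ⟨J'⟩ d⁻¹` is generated by the letters of `J` that `d` conjugates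
into `J'`. -/
theorem mem_closure_of_conj_mem_closure (hS : HasExchange S) (hJ : J ⊆ S) (hJ' : J' ⊆ S) {d : W}
    (hd : ∀ x ∈ Subgroup.closure J, ∀ y ∈ Subgroup.closure J',
      wordLength S d ≤ wordLength S (x * d * y)) {x : W} (hx : x ∈ Subgroup.closure J)
    (hxd : d⁻¹ * x * d ∈ Subgroup.closure J') :
    x ∈ Subgroup.closure {s ∈ J | d⁻¹ * s * d ∈ J'} := by
  have hdl : ∀ x ∈ Subgroup.closure J, wordLength S d ≤ wordLength S (x * d) := fun x hx => by
    simpa using hd x hx 1 (one_mem _)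
  have hdr : ∀ y ∈ Subgroup.closure J', wordLength S d ≤ wordLength S (d * y) := fun y hy => by
    simpa using hd 1 (one_mem _) y hy
  obtain ⟨ω, hω, rfl, hl⟩ := hS.exists_word_of_mem_closure hJ hx
  clear hx
  induction ω with
  | nil => simp
  | cons s ω ih =>
    have hsJ : s ∈ J := hω s (by simp)
    have hωJ : ∀ x ∈ ω, x ∈ J := fun x hx => hω x (by simp [hx])
    have hs := hJ hsJ
    have hss := hS.mul_self s hs
    have hωS : ∀ x ∈ ω, x ∈ S := fun x hx => hJ (hωJ x hx)
    have h2 := wordLength_prod_le hωS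
    have h1 := hS.wordLength_letter_mul_le hs ω.prod
    have h3 := hS.wordLength_mul_of_minimal hJ hdl (prod_mem_closure hω)
    have h4 := hS.wordLength_mul_of_minimal hJ hdl (prod_mem_closure hωJ)
    have h5 := hS.wordLength_mul_of_minimal hJ hdl (Subgroup.subset_closure hsJ)
    rw [hS.wordLength_of_mem hs] at h5
    rw [List.length_cons] at hl
    obtain ⟨δ, hδ, hδd, hδl⟩ := hS.exists_word d
    obtain ⟨η, hη, hηy, hηl⟩ := hS.exists_word_of_mem_closure hJ' hxd
    have key : d * η.prod = (s :: ω).prod * d := by rw [hηy]; group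
    have key2 : s * (d * η.prod) = ω.prod * d := by
      rw [key, List.prod_cons, ← mul_assoc, ← mul_assoc, hss, one_mul]
    -- The letter `s` shortens `d y`, where `y = d⁻¹ x d`; the omitted letter belongs to `y`,
    -- which exhibits `d⁻¹ s d` as an element of `⟨J'⟩`.
    have hz : d⁻¹ * s * d ∈ Subgroup.closure J' := by
      rcases hS.exchange_mul hs hδ (fun x hx => hJ' (hη x hx)) (by
        rw [hδd, key2, key, h3, h4, ← hl]; omega) with
        ⟨δ', hsub, hl', hp⟩ | ⟨η', hsub, hl', hp⟩
      · have := wordLength_prod_le (S := S) (ω := δ') fun x hx => hδ x (hsub.subset hx)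
        rw [← hp, hδd] at this
        omega
      · have : d⁻¹ * s * d = η'.prod * η.prod⁻¹ := by
          rw [hδd] at hp
          rw [eq_mul_inv_iff_mul_eq, mul_assoc, mul_assoc, ← mul_assoc s, hp,
            inv_mul_cancel_left]
        rw [this]
        exact mul_mem (prod_mem_closure fun x hx => hη x (hsub.subset hx))
          (inv_mem (prod_mem_closure hη))
    have hzJ : d⁻¹ * s * d ∈ J' := by
      have h6 := hS.wordLength_mul_of_minimal_right hJ' hdr hz
      rw [← mul_assoc, mul_inv_cancel_left] at h6
      exact hS.mem_of_mem_closure hJ' (hS.mem_of_wordLength (by omega)) hz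
    rw [List.prod_cons]
    refine mul_mem (Subgroup.subset_closure ⟨hsJ, hzJ⟩) (ih hωJ ?_ ?_)
    · have : d⁻¹ * ω.prod * d = (d⁻¹ * s * d)⁻¹ * (d⁻¹ * (s :: ω).prod * d) := by
        rw [List.prod_cons]; group
      rw [this]
      exact mul_mem (inv_mem hz) hxd
    · rw [List.prod_cons] at hl
      omega

end HasExchange

end Exchange

end BNPairs

namespace BNPairs

/-! ### Essential sets of letters -/

section Essential

variable {W : Type*} [Group W]

/-- `I` is essential if `⟨I'⟩` has infinite index in `⟨I⟩` for every proper subset `I'` of `I`.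
For a Coxeter group of finite rank it means that no irreducible component of `⟨I⟩` is finite. -/
def IsEssential (I : Set W) : Prop :=
  ∀ I' ⊆ I, (Subgroup.closure I').relIndex (Subgroup.closure I) ≠ 0 → I' = I

theorem exists_isEssential {J : Set W} (hJ : J.Finite) :
    ∃ I ⊆ J, IsEssential I ∧ (Subgroup.closure I).relIndex (Subgroup.closure J) ≠ 0 := by
  obtain ⟨I, ⟨hIJ, hI⟩, hmin⟩ := Set.Finite.exists_minimal
    (s := {I | I ⊆ J ∧ (Subgroup.closure I).relIndex (Subgroup.closure J) ≠ 0})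
    (hJ.finite_subsets.subset fun I hI => hI.1) ⟨J, subset_rfl, by simp⟩
  exact ⟨I, hIJ, fun I' hI' h => subset_antisymm hI'
    (hmin ⟨hI'.trans hIJ, Subgroup.relIndex_ne_zero_trans h hI⟩ hI'), hI⟩

/-- The letters that commute with all elements of `I`. -/
def perp (S I : Set W) : Set W := {t ∈ S | ∀ s ∈ I, s * t = t * s}

theorem commute_of_mem_closure_perp {S I : Set W} {w x : W}
    (hw : w ∈ Subgroup.closure (perp S I)) (hx : x ∈ Subgroup.closure I) : x * w = w * x := by
  have h : perp S I ⊆ Subgroup.centralizer (Subgroup.closure I : Set W) := fun t ht => by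
    rw [Subgroup.centralizer_closure]
    exact Subgroup.mem_centralizer_iff.2 ht.2
  exact Subgroup.mem_centralizer_iff.1 ((Subgroup.closure_le _).2 h hw) x hx

namespace HasExchange

variable {S I J : Set W}

/-- A letter `t ∉ I` with only finitely many conjugates under `⟨I⟩`, `I` essential,
commutes with `I`. -/
theorem mem_perp_of_finite_conj (hS : HasExchange S) (hI : I ⊆ S) (hess : IsEssential I) {t : W}
    (ht : t ∈ S) (htI : t ∉ I)
    (hfin : ((fun w => w * t * w⁻¹) '' (Subgroup.closure I : Set W)).Finite) :
    t ∈ perp S I := by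
  have hts := hS.mul_self t ht
  have hti : t⁻¹ = t := inv_eq_self_of_mul_self hS.mul_self ht
  have htc : t ∉ Subgroup.closure I := fun h => htI (hS.mem_of_mem_closure hI ht h)
  have hmin : ∀ x ∈ Subgroup.closure I, ∀ y ∈ Subgroup.closure I,
      wordLength S t ≤ wordLength S (x * t * y) := by
    intro x hx y hy
    rw [hS.wordLength_of_mem ht, Nat.one_le_iff_ne_zero]
    intro h0
    refine htc ?_
    have h1 := hS.eq_one_of_wordLength h0
    have h2 : t = x⁻¹ * y⁻¹ := by
      rw [eq_inv_mul_iff_mul_eq, eq_inv_iff_mul_eq_one, h1]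
    rw [h2]
    exact mul_mem (inv_mem hx) (inv_mem hy)
  have hall := hess {s ∈ I | t⁻¹ * s * t ∈ I} (fun s hs => hs.1) <| by
    refine relIndex_ne_zero_of_finite_image _ hfin fun x hx y hy hxy => ?_
    refine hS.mem_closure_of_conj_mem_closure hI hI hmin (mul_mem (inv_mem hx) hy) ?_
    have : t⁻¹ * (x⁻¹ * y) * t = x⁻¹ * y := by
      have h3 : x⁻¹ * y * t = t * (x⁻¹ * y) := by
        have := congrArg (fun z => x⁻¹ * z * y) hxy
        simpa [mul_assoc] using this.symm
      rw [mul_assoc, h3, inv_mul_cancel_left]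
    rw [this]
    exact mul_mem (inv_mem hx) hy
  refine ⟨ht, fun s hs => ?_⟩
  -- The letter `t s t` lies both in `⟨I⟩` and in `⟨s, t⟩`, hence in `⟨s⟩`.
  have hsS := hI hs
  rw [← hall] at hs
  obtain ⟨hs, hst⟩ := hs
  have hmem : t⁻¹ * s * t ∈ ({s, t} : Set W) := by
    refine hS.mem_of_mem_closure ?_ (hI hst) ?_
    · rintro x (rfl | rfl)
      exacts [hsS, ht]
    · have h1 : s ∈ Subgroup.closure ({s, t} : Set W) := Subgroup.subset_closure (by simp)
      have h2 : t ∈ Subgroup.closure ({s, t} : Set W) := Subgroup.subset_closure (by simp)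
      exact mul_mem (mul_mem (inv_mem h2) h1) h2
  rcases hmem with h | h
  · rwa [mul_assoc, inv_mul_eq_iff_eq_mul] at h
  · exact absurd (h ▸ hst) htI

/-- If `I` is essential and `d`, of minimal length in `⟨I⟩ d`, conjugates `I` into the set of
letters, then `d` is a product of letters that commute with `I`. -/
theorem mem_closure_perp (hS : HasExchange S) (hI : I ⊆ S) (hess : IsEssential I) {d : W}
    (hd : ∀ x ∈ Subgroup.closure I, wordLength S d ≤ wordLength S (x * d))
    (hconj : ∀ s ∈ I, d⁻¹ * s * d ∈ S) : d ∈ Subgroup.closure (perp S I) := by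
  obtain ⟨n, hn⟩ : ∃ n, wordLength S d = n := ⟨_, rfl⟩
  induction n generalizing d with
  | zero => rw [hS.eq_one_of_wordLength hn]; exact one_mem _
  | succ n ih =>
    obtain ⟨δ, hδ, hδd, hδl⟩ := hS.exists_word d
    rcases δ with - | ⟨t, ε⟩
    · rw [List.length_nil] at hδl; omega
    have ht : t ∈ S := hδ t (by simp)
    have htt := hS.mul_self t ht
    have hε : t * d = ε.prod := by
      rw [← hδd, List.prod_cons, ← mul_assoc, htt, one_mul]
    have htd : wordLength S (t * d) ≤ n := by
      rw [hε]
      refine (wordLength_prod_le fun x hx => hδ x (by simp [hx])).trans ?_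
      rw [List.length_cons] at hδl
      omega
    have htI : t ∉ I := fun h => by
      have := hd t (Subgroup.subset_closure h)
      omega
    have hlen : ∀ w ∈ Subgroup.closure I, wordLength S (d⁻¹ * w * d) ≤ wordLength S w := by
      intro w hw
      obtain ⟨ω, hω, rfl, hl⟩ := hS.exists_word_of_mem_closure hI hw
      rw [← hl]
      have h1 : d⁻¹ * ω.prod * d = (ω.map fun x => d⁻¹ * x * d).prod := by
        have e : ⇑(MulAut.conj d⁻¹) = fun x => d⁻¹ * x * d := by
          funext x
          rw [MulAut.conj_apply, inv_inv]
        simpa only [e] using map_list_prod (MulAut.conj d⁻¹) ω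
      rw [h1, ← List.length_map (as := ω) (fun x => d⁻¹ * x * d)]
      refine wordLength_prod_le fun x hx => ?_
      obtain ⟨y, hy, rfl⟩ := List.mem_map.1 hx
      exact hconj y (hω y hy)
    -- For `w` in `⟨I⟩` the letter `t` shortens `w⁻¹ d`, because it shortens `d` and
    -- `w⁻¹ d = d w'` with `w'` no longer than `w`. The omitted letter belongs to `d`, since
    -- `t ∉ ⟨I⟩`; so `w t w⁻¹ d` is a subword of a fixed word for `d`.
    have hfin : ((fun w => w * t * w⁻¹) '' (Subgroup.closure I : Set W)).Finite := by
      refine Set.Finite.subset ((List.finite_toSet (t :: ε).sublists).image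
        fun δ' : List W => δ'.prod * d⁻¹) ?_
      rintro _ ⟨w, hw, rfl⟩
      have hw' : w⁻¹ ∈ Subgroup.closure I := inv_mem hw
      obtain ⟨ω, hω, hωw, hl⟩ := hS.exists_word_of_mem_closure hI hw'
      have h1 : wordLength S (t * (ω.prod * (t :: ε).prod)) ≤
          wordLength S (ω.prod * (t :: ε).prod) := by
        rw [hδd, hωw, hS.wordLength_mul_of_minimal hI hd hw']
        have h2 : t * (w⁻¹ * d) = t * d * (d⁻¹ * w⁻¹ * d) := by group
        have h3 := hS.wordLength_mul_le (t * d) (d⁻¹ * w⁻¹ * d)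
        have h4 := hlen _ hw'
        rw [h2]
        omega
      rcases hS.exchange_mul ht (fun x hx => hI (hω x hx)) hδ h1 with
        ⟨ω', hsub, -, hp⟩ | ⟨δ', hsub, -, hp⟩
      · refine absurd (hS.mem_of_mem_closure hI ht ?_) htI
        rw [← eq_mul_inv_iff_mul_eq] at hp
        rw [hp]
        exact mul_mem (prod_mem_closure fun x hx => hω x (hsub.subset hx))
          (inv_mem (prod_mem_closure hω))
      · refine ⟨δ', List.mem_sublists.2 hsub, ?_⟩
        rw [hδd, hωw] at hp
        have : δ'.prod = w * t * w⁻¹ * d := by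
          rw [mul_assoc w, mul_assoc w, hp, mul_inv_cancel_left]
        simp [this]
    have htp := hS.mem_perp_of_finite_conj hI hess ht htI hfin
    have hdt : d = t * (t * d) := by rw [← mul_assoc, htt, one_mul]
    rw [hdt]
    refine mul_mem (Subgroup.subset_closure htp) (ih ?_ ?_ ?_)
    · intro x hx
      have h1 := commute_of_mem_closure_perp (Subgroup.subset_closure htp) hx
      rw [← mul_assoc, h1, mul_assoc]
      have h2 := hS.wordLength_le_letter_mul ht (x * d)
      have h3 := hd x hx
      omega
    · intro s hs
      have h1 : (t * d)⁻¹ * s * (t * d) = d⁻¹ * s * d := by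
        have h2 := htp.2 s hs
        calc (t * d)⁻¹ * s * (t * d) = d⁻¹ * t⁻¹ * (s * t) * d := by group
          _ = d⁻¹ * s * d := by rw [h2]; group
      rw [h1]
      exact hconj s hs
    · have := hS.wordLength_le_letter_mul ht d
      omega

/-- If `⟨I⟩`, `I` essential, is virtually contained in a conjugate of `⟨J⟩`, then `I ⊆ J`
and the conjugating element centralizes `⟨I⟩` up to factors from `⟨I⟩` and `⟨J⟩`. -/
theorem subset_of_relIndex_conj_ne_zero (hS : HasExchange S) (hI : I ⊆ S) (hJ : J ⊆ S)
    (hess : IsEssential I) {v : W}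
    (hv : (MulAut.conj v • Subgroup.closure J).relIndex (Subgroup.closure I) ≠ 0) :
    I ⊆ J ∧ ∃ x ∈ Subgroup.closure I, ∃ d ∈ Subgroup.closure (perp S I),
      ∃ y ∈ Subgroup.closure J, v = x * d * y := by
  -- `d` is a representative of minimal length of the double coset of `v`.
  obtain ⟨d, ⟨a, ha, b, hb, hab⟩, hmin⟩ := WellFounded.has_min (measure (wordLength S)).wf
    {d | ∃ a ∈ Subgroup.closure I, ∃ b ∈ Subgroup.closure J, d = a * v * b}
    ⟨v, 1, one_mem _, 1, one_mem _, by simp⟩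
  have hd : ∀ x ∈ Subgroup.closure I, ∀ y ∈ Subgroup.closure J,
      wordLength S d ≤ wordLength S (x * d * y) := fun x hx y hy => not_lt.1 <|
    hmin _ ⟨x * a, mul_mem hx ha, b * y, mul_mem hb hy, by rw [hab]; group⟩
  have hd' : (MulAut.conj d • Subgroup.closure J).relIndex (Subgroup.closure I) ≠ 0 := by
    rw [hab, map_mul, map_mul, mul_smul, mul_smul, Subgroup.conj_smul_eq_self_of_mem hb]
    rwa [← Subgroup.relIndex_pointwise_smul (MulAut.conj a),
      Subgroup.conj_smul_eq_self_of_mem ha] at hv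
  have hall := hess {s ∈ I | d⁻¹ * s * d ∈ J} (fun s hs => hs.1) <| by
    rw [← Subgroup.inf_relIndex_right] at hd'
    refine fun h0 => hd' (Subgroup.relIndex_eq_zero_of_le_left ?_ h0)
    rintro x ⟨hx, hxI⟩
    exact hS.mem_closure_of_conj_mem_closure hI hJ hd hxI (mem_conj_smul.1 hx)
  have hconj : ∀ s ∈ I, d⁻¹ * s * d ∈ J := fun s hs => by
    rw [← hall] at hs
    exact hs.2
  have hdp := hS.mem_closure_perp hI hess (fun x hx => by simpa using hd x hx 1 (one_mem _))
    fun s hs => hJ (hconj s hs)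
  refine ⟨fun s hs => ?_, a⁻¹, inv_mem ha, d, hdp, b⁻¹, inv_mem hb, by rw [hab]; group⟩
  have := hconj s hs
  rwa [mul_assoc, commute_of_mem_closure_perp hdp (Subgroup.subset_closure hs),
    inv_mul_cancel_left] at this

end HasExchange

end Essential

end BNPairs

namespace BNPairs

namespace BNPair

variable {G : Type*} [Group G] (P : BNPair G)

/-! ### The Bruhat decomposition -/

/-- The Bruhat cell `B w B`. The index ranges over the Weyl group, so that representatives in `N`
do not appear. -/
abbrev cell (w : P.Weyl) : Set G := doubleCoset P.B P.N w

variable {P}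

theorem coe_mem_cell (n : P.N) : (n : G) ∈ P.cell (n : P.Weyl) :=
  ⟨1, one_mem _, n, rfl, 1, one_mem _, by simp⟩

theorem mul_mem_cell_left {w : P.Weyl} {b x : G} (hb : b ∈ P.B) (hx : x ∈ P.cell w) :
    b * x ∈ P.cell w := by
  obtain ⟨c, hc, n, hn, c', hc', rfl⟩ := hx
  exact ⟨b * c, mul_mem hb hc, n, hn, c', hc', by simp [mul_assoc]⟩

theorem mul_mem_cell_right {w : P.Weyl} {b x : G} (hx : x ∈ P.cell w) (hb : b ∈ P.B) :
    x * b ∈ P.cell w := by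
  obtain ⟨c, hc, n, hn, c', hc', rfl⟩ := hx
  exact ⟨c, hc, n, hn, c' * b, mul_mem hc' hb, by simp [mul_assoc]⟩

theorem coe_mem_B_iff (n : P.N) : (n : G) ∈ P.B ↔ (n : P.Weyl) = 1 := by
  rw [QuotientGroup.eq_one_iff, Subgroup.mem_subgroupOf]

theorem mem_cell_one {x : G} : x ∈ P.cell 1 ↔ x ∈ P.B := by
  constructor
  · rintro ⟨b, hb, n, hn, b', hb', rfl⟩
    exact mul_mem (mul_mem hb ((coe_mem_B_iff n).2 hn)) hb'
  · exact fun hx => ⟨x, hx, 1, rfl, 1, one_mem _, by simp⟩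

theorem inv_mem_cell {w : P.Weyl} {x : G} (hx : x ∈ P.cell w) : x⁻¹ ∈ P.cell w⁻¹ := by
  obtain ⟨b, hb, n, rfl, b', hb', rfl⟩ := hx
  exact ⟨b'⁻¹, inv_mem hb', n⁻¹, rfl, b⁻¹, inv_mem hb, by simp [mul_assoc]⟩

theorem cell_nonempty (w : P.Weyl) : (P.cell w).Nonempty := by
  obtain ⟨n, rfl⟩ := QuotientGroup.mk_surjective w
  exact ⟨n, coe_mem_cell n⟩

/-- A cell is a single double coset of `B`. -/
theorem exists_eq_mul_of_mem_cell {w : P.Weyl} {x y : G} (hx : x ∈ P.cell w)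
    (hy : y ∈ P.cell w) : ∃ b ∈ P.B, ∃ b' ∈ P.B, y = b * x * b' := by
  obtain ⟨b, hb, n, rfl, b', hb', rfl⟩ := hx
  obtain ⟨c, hc, m, hm, c', hc', rfl⟩ := hy
  have ht : (n : G)⁻¹ * m ∈ P.B := by
    have := QuotientGroup.eq.1 hm.symm
    rwa [Subgroup.mem_subgroupOf] at this
  exact ⟨c * b⁻¹, mul_mem hc (inv_mem hb), b'⁻¹ * ((n : G)⁻¹ * m) * c',
    mul_mem (mul_mem (inv_mem hb') ht) hc', by group⟩

theorem exists_mul_of_mem_cell_mul {v w : P.Weyl} {x : G} (hx : x ∈ P.cell (v * w)) :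
    ∃ y ∈ P.cell v, ∃ z ∈ P.cell w, x = y * z := by
  obtain ⟨b, hb, n, hn, b', hb', rfl⟩ := hx
  obtain ⟨m, rfl⟩ := QuotientGroup.mk_surjective v
  refine ⟨b * m, mul_mem_cell_left hb (coe_mem_cell m), (m⁻¹ * n : P.N) * b',
    mul_mem_cell_right ?_ hb', by simp [mul_assoc]⟩
  have := coe_mem_cell (m⁻¹ * n)
  rwa [QuotientGroup.mk_mul, QuotientGroup.mk_inv, hn, inv_mul_cancel_left] at this

theorem letter_inv {s : P.Weyl} (hs : s ∈ P.S) : s⁻¹ = s :=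
  inv_eq_self_of_mul_self P.mul_self hs

theorem mul_letter_mem {s w : P.Weyl} (hs : s ∈ P.S) {x y : G} (hx : x ∈ P.cell w)
    (hy : y ∈ P.cell s) : x * y ∈ P.cell w ∨ x * y ∈ P.cell (w * s) :=
  P.mul_subset s hs w (Set.mul_mem_mul hx hy)

theorem letter_mul_mem {s w : P.Weyl} (hs : s ∈ P.S) {x y : G} (hx : x ∈ P.cell s)
    (hy : y ∈ P.cell w) : x * y ∈ P.cell w ∨ x * y ∈ P.cell (s * w) := by
  have hx' := inv_mem_cell hx
  rw [letter_inv hs] at hx'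
  rcases mul_letter_mem hs (inv_mem_cell hy) hx' with h | h
  · left
    simpa using inv_mem_cell h
  · right
    simpa [letter_inv hs] using inv_mem_cell h

theorem letter_ne_one {s : P.Weyl} (hs : s ∈ P.S) : s ≠ 1 := by
  obtain ⟨n, rfl⟩ := QuotientGroup.mk_surjective s
  intro h
  refine P.not_conj_le n hs (le_of_eq ?_)
  exact Subgroup.conj_smul_eq_self_of_mem ((coe_mem_B_iff n).2 h)

/-- The failure of `s B s⁻¹ ⊆ B`, in the form that the cell of `s` is not disjoint from its own
square. -/
theorem exists_mul_mem_cell_letter {s : P.Weyl} (hs : s ∈ P.S) :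
    ∃ x ∈ P.cell s, ∃ y ∈ P.cell s, x * y ∈ P.cell s := by
  obtain ⟨n, rfl⟩ := QuotientGroup.mk_surjective s
  obtain ⟨x, hx, hxB⟩ := SetLike.not_le_iff_exists.1 (P.not_conj_le n hs)
  rw [mem_conj_smul] at hx
  have h1 : (n : G) * ((n : G)⁻¹ * x * n) ∈ P.cell (n : P.Weyl) :=
    mul_mem_cell_right (coe_mem_cell n) hx
  have h2 := inv_mem_cell (coe_mem_cell n)
  rw [letter_inv hs] at h2
  have e : (n : G) * ((n : G)⁻¹ * x * n) * (n : G)⁻¹ = x := by group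
  refine ⟨_, h1, _, h2, ?_⟩
  rcases mul_letter_mem hs h1 h2 with h | h
  · exact h
  · rw [P.mul_self _ hs, e, mem_cell_one] at h
    exact absurd h hxB

theorem exists_reduced_word (w : P.Weyl) : ∃ ω : List P.Weyl,
    (∀ x ∈ ω, x ∈ P.S) ∧ ω.prod = w ∧ ω.length = wordLength P.S w :=
  exists_word_of_involutions P.closure_S P.mul_self w

theorem wordLength_letter_mul_le {s : P.Weyl} (hs : s ∈ P.S) (w : P.Weyl) :
    wordLength P.S (s * w) ≤ wordLength P.S w + 1 := by
  have h1 := wordLength_mul_le_of_involutions P.closure_S P.mul_self s w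
  have h2 : wordLength P.S s ≤ 1 := by
    simpa using wordLength_prod_le (S := P.S) (ω := [s]) (by simpa using hs)
  omega

/-- Disjointness of cells, by induction on the shorter of two reduced words: a letter is moved
from the product of the shorter word to `w`. -/
theorem eq_of_mem_cell_of_length_le (ω : List P.Weyl) (hω : ∀ x ∈ ω, x ∈ P.S)
    (hl : ω.length ≤ wordLength P.S ω.prod) {w : P.Weyl} (hw : ω.length ≤ wordLength P.S w)
    {x : G} (hx : x ∈ P.cell ω.prod) (hx' : x ∈ P.cell w) : ω.prod = w := by
  induction ω generalizing w x with
  | nil =>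
    obtain ⟨b, hb, n, hn, b', hb', rfl⟩ := hx'
    rw [List.prod_nil, mem_cell_one] at hx
    rw [List.prod_nil, ← hn]
    refine ((coe_mem_B_iff n).1 ?_).symm
    have : (n : G) = b⁻¹ * (b * n * b') * b'⁻¹ := by group
    rw [this]
    exact mul_mem (mul_mem (inv_mem hb) hx) (inv_mem hb')
  | cons s ω ih =>
    have hs : s ∈ P.S := hω s (by simp)
    have hss := P.mul_self s hs
    have hωS : ∀ x ∈ ω, x ∈ P.S := fun x hx => hω x (by simp [hx])
    rw [List.length_cons] at hw
    rw [List.prod_cons] at hx ⊢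
    rw [List.prod_cons, List.length_cons] at hl
    replace ih := @ih hωS (by have := wordLength_letter_mul_le hs ω.prod; omega)
    obtain ⟨y, hy, z, hz, rfl⟩ := exists_mul_of_mem_cell_mul hx
    have hy' := inv_mem_cell hy
    rw [letter_inv hs] at hy'
    have h := letter_mul_mem hs hy' hx'
    rw [inv_mul_cancel_left] at h
    rcases h with h | h
    · -- This case does not occur, because `ω.prod` is shorter than `w`.
      have e := ih (by omega) hz h
      have := wordLength_prod_le hωS
      rw [e] at this
      omega
    · have h1 := wordLength_letter_mul_le hs (s * w)
      rw [← mul_assoc, hss, one_mul] at h1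
      rw [ih (by omega) hz h, ← mul_assoc, hss, one_mul]

/-- Distinct elements of the Weyl group have disjoint Bruhat cells. -/
theorem eq_of_mem_cell {v w : P.Weyl} {x : G} (hv : x ∈ P.cell v) (hw : x ∈ P.cell w) :
    v = w := by
  obtain ⟨ω, hω, rfl, hl⟩ := exists_reduced_word v
  obtain ⟨ν, hν, rfl, hl'⟩ := exists_reduced_word w
  rcases le_total ω.length ν.length with h | h
  · exact eq_of_mem_cell_of_length_le ω hω hl.le (h.trans hl'.le) hv hw
  · exact (eq_of_mem_cell_of_length_le ν hν hl'.le (h.trans hl.le) hw hv).symm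

theorem exists_mem_cell (g : G) : ∃ w : P.Weyl, g ∈ P.cell w := by
  have h : P.parabolic P.S subset_rfl = ⊤ := by
    rw [eq_top_iff, ← P.sup_eq_top, sup_le_iff]
    refine ⟨fun b hb => ⟨1, one_mem _, mem_cell_one.2 hb⟩, fun n hn => 
      ⟨((⟨n, hn⟩ : P.N) : P.Weyl), ?_, coe_mem_cell ⟨n, hn⟩⟩⟩
    rw [P.closure_S]; trivial
  obtain ⟨w, -, hw⟩ := h.symm ▸ Subgroup.mem_top g
  exact ⟨w, hw⟩

/-! ### The exchange condition for the Weyl group -/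

/-- `w` is ascending for the letter `s` if `BsB · BwB = BswB`, equivalently if `BsB · BwB` is
disjoint from `BwB`. -/
def IsAscent (s w : P.Weyl) : Prop :=
  ∀ x ∈ P.cell s, ∀ y ∈ P.cell w, x * y ∉ P.cell w

theorem IsAscent.mul_mem {s w : P.Weyl} (h : IsAscent s w) (hs : s ∈ P.S) {x y : G}
    (hx : x ∈ P.cell s) (hy : y ∈ P.cell w) : x * y ∈ P.cell (s * w) :=
  (letter_mul_mem hs hx hy).resolve_left (h x hx y hy)

theorem isAscent_one {s : P.Weyl} (hs : s ∈ P.S) : IsAscent s (1 : P.Weyl) := by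
  intro x hx y hy h
  have h1 := mul_mem_cell_right hx (mem_cell_one.1 hy)
  exact letter_ne_one hs (eq_of_mem_cell h1 h)

theorem IsAscent.not_isAscent_mul {s w : P.Weyl} (h : IsAscent s w) (hs : s ∈ P.S) :
    ¬ IsAscent s (s * w) := by
  intro h'
  obtain ⟨x, hx, y, hy, hxy⟩ := exists_mul_mem_cell_letter hs
  obtain ⟨z, hz⟩ := P.cell_nonempty w
  have h1 := h'.mul_mem hs hx (h.mul_mem hs hy hz)
  rw [← mul_assoc, ← mul_assoc, P.mul_self s hs, one_mul] at h1
  exact h _ hxy z hz h1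

/-- The cell of `w t` meets `BsB · BwB · BtB = BswB · BtB`, so `w t` is `s w` or `s w t`, and the
latter is impossible. -/
theorem IsAscent.mul_eq_mul {s t w : P.Weyl} (h : IsAscent s w) (hs : s ∈ P.S) (ht : t ∈ P.S)
    (h' : ¬ IsAscent s (w * t)) : s * w = w * t := by
  simp only [IsAscent, not_forall, not_not] at h'
  obtain ⟨x, hx, y, hy, hxy⟩ := h'
  obtain ⟨u, hu, z, hz, rfl⟩ := exists_mul_of_mem_cell_mul hy
  rw [← mul_assoc] at hxy
  rcases mul_letter_mem ht (h.mul_mem hs hx hu) hz with h1 | h1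
  · exact eq_of_mem_cell h1 hxy
  · have := eq_of_mem_cell h1 hxy
    rw [mul_assoc] at this
    exact absurd (mul_right_cancel (b := w * t) (this.trans (one_mul _).symm)) (letter_ne_one hs)

/-- The word is not assumed reduced. The omitted letter is the last letter of the first prefix
whose product is not ascending for `s`. -/
theorem exists_sublist_of_not_isAscent {s : P.Weyl} (hs : s ∈ P.S) (ω : List P.Weyl)
    (hω : ∀ x ∈ ω, x ∈ P.S) (h : ¬ IsAscent s ω.prod) :
    ∃ ω' : List P.Weyl, ω'.Sublist ω ∧ ω'.length + 1 = ω.length ∧ s * ω.prod = ω'.prod := by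
  induction ω using List.reverseRecOn with
  | nil => exact absurd (isAscent_one hs) h
  | append_singleton ω t ih =>
    have ht : t ∈ P.S := hω t (by simp)
    rw [List.prod_append, List.prod_singleton] at h ⊢
    by_cases h1 : IsAscent s ω.prod
    · refine ⟨ω, List.sublist_append_left _ _, by simp, ?_⟩
      rw [← mul_assoc, h1.mul_eq_mul hs ht h, mul_assoc, P.mul_self t ht, mul_one]
    · obtain ⟨ω', hsub, hl, hp⟩ := ih (fun x hx => hω x (by simp [hx])) h1
      refine ⟨ω' ++ [t], hsub.append_right _, by simp [hl], ?_⟩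
      rw [← mul_assoc, hp, List.prod_append, List.prod_singleton]

theorem wordLength_lt_of_not_isAscent {s w : P.Weyl} (hs : s ∈ P.S) (h : ¬ IsAscent s w) :
    wordLength P.S (s * w) < wordLength P.S w := by
  obtain ⟨ω, hω, rfl, hl⟩ := exists_reduced_word w
  obtain ⟨ω', hsub, hl', hp⟩ := exists_sublist_of_not_isAscent hs ω hω h
  have := wordLength_prod_le (S := P.S) (ω := ω') fun x hx => hω x (hsub.subset hx)
  rw [hp]
  omega

/-- If `s w` is not longer than `w`, then `w` is not ascending for `s`: otherwise `s w` would not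
be, and `w = s (s w)` would be shorter than `s w`. -/
theorem hasExchange (P : BNPair G) : HasExchange P.S where
  closure_eq := P.closure_S
  mul_self := P.mul_self
  exchange s hs ω hω hle := by
    refine exists_sublist_of_not_isAscent hs ω hω fun h => ?_
    have := wordLength_lt_of_not_isAscent hs (h.not_isAscent_mul hs)
    rw [← mul_assoc, P.mul_self s hs, one_mul] at this
    omega

end BNPair

end BNPairs

namespace BNPairs

namespace BNPair

variable {G : Type*} [Group G] {P : BNPair G}

/-! ### Virtual containment of parabolic subgroups -/

theorem cell_subset_parabolic {J : Set P.Weyl} (hJ : J ⊆ P.S) {w : P.Weyl}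
    (hw : w ∈ Subgroup.closure J) {x : G} (hx : x ∈ P.cell w) : x ∈ P.parabolic J hJ :=
  ⟨w, hw, hx⟩

theorem B_le_parabolic {J : Set P.Weyl} (hJ : J ⊆ P.S) : P.B ≤ P.parabolic J hJ :=
  fun _ hb => cell_subset_parabolic hJ (one_mem _) (mem_cell_one.2 hb)

/-- For a representative `n` of `w`, the cosets of `B` in `B n B` correspond to the cosets of
`B ∩ n B n⁻¹` in `B`, and there are finitely many since `B` is commensurated. -/
theorem exists_cover_cell (hB : IsCommensurated P.B) (w : P.Weyl) :
    ∃ E : Set G, E.Finite ∧ P.cell w ⊆ E * (P.B : Set G) := by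
  obtain ⟨n, rfl⟩ := QuotientGroup.mk_surjective w
  obtain ⟨F, hF, hBF⟩ := relIndex_ne_zero_iff_exists_cover.1 (hB n).1
  refine ⟨F * {(n : G)}, hF.mul (Set.finite_singleton _), fun x hx => ?_⟩
  obtain ⟨b, hb, c, hc, rfl⟩ := exists_eq_mul_of_mem_cell (coe_mem_cell n) hx
  obtain ⟨f, hf, a, ha, rfl⟩ := Set.mem_mul.1 (hBF hb)
  exact Set.mem_mul.2 ⟨f * n, Set.mul_mem_mul hf rfl, (n : G)⁻¹ * a * n * c,
    mul_mem (mem_conj_smul.1 ha) hc, by group⟩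

/-- A set that meets only cells `B a u B` with `u ∈ ⟨J⟩` and `a` from a finite set is covered by
finitely many cosets of `P_J`. -/
theorem exists_cover_of_forall_mem_cell (hB : IsCommensurated P.B) {J : Set P.Weyl}
    (hJ : J ⊆ P.S) {F : Set P.Weyl} (hF : F.Finite) {A : Set G}
    (hA : ∀ x ∈ A, ∃ a ∈ F, ∃ u ∈ Subgroup.closure J, x ∈ P.cell (a * u)) :
    ∃ E : Set G, E.Finite ∧ A ⊆ E * (P.parabolic J hJ : Set G) := by
  choose E hE hcover using fun w : P.Weyl => exists_cover_cell hB w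
  refine ⟨⋃ a ∈ F, E a, hF.biUnion fun a _ => hE a, fun x hx => ?_⟩
  obtain ⟨a, ha, u, hu, hxu⟩ := hA x hx
  obtain ⟨y, hy, z, hz, rfl⟩ := exists_mul_of_mem_cell_mul hxu
  obtain ⟨e, he, b, hb, rfl⟩ := Set.mem_mul.1 (hcover a hy)
  exact Set.mem_mul.2 ⟨e, Set.mem_biUnion ha he, b * z,
    mul_mem (B_le_parabolic hJ hb) (cell_subset_parabolic hJ hu hz), by rw [mul_assoc]⟩

theorem parabolic_relIndex_ne_zero (hB : IsCommensurated P.B) {J J' : Set P.Weyl} (hJ : J ⊆ P.S)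
    (hJ' : J' ⊆ P.S) (h : (Subgroup.closure J').relIndex (Subgroup.closure J) ≠ 0) :
    (P.parabolic J' hJ').relIndex (P.parabolic J hJ) ≠ 0 := by
  obtain ⟨F, hF, hc⟩ := relIndex_ne_zero_iff_exists_cover.1 h
  refine relIndex_ne_zero_iff_exists_cover.2 (exists_cover_of_forall_mem_cell hB hJ' hF ?_)
  rintro x ⟨w, hw, hx⟩
  obtain ⟨a, ha, u, hu, rfl⟩ := Set.mem_mul.1 (hc hw)
  exact ⟨a, ha, u, hu, hx⟩

/-- The product of `B w B` with any cell `B u B` meets only cells `B a u B` with `a` from a finite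
set that depends only on `w`. -/
theorem exists_finite_forall_mul_mem_cell (w : P.Weyl) : ∃ F : Set P.Weyl, F.Finite ∧
    ∀ u, ∀ x ∈ P.cell w, ∀ y ∈ P.cell u, ∃ a ∈ F, x * y ∈ P.cell (a * u) := by
  have hw : w ∈ Subgroup.closure P.S := by rw [P.closure_S]; trivial
  refine closure_induction_of_involutions P.mul_self ?_ ?_ hw
  · exact ⟨{1}, Set.finite_singleton _, fun u x hx y hy => ⟨1, rfl, by
      rw [one_mul]; exact mul_mem_cell_left (mem_cell_one.1 hx) hy⟩⟩
  · rintro s hs w - ⟨F, hF, h⟩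
    refine ⟨F ∪ (s * ·) '' F, hF.union (hF.image _), fun u x hx y hy => ?_⟩
    obtain ⟨p, hp, z, hz, rfl⟩ := exists_mul_of_mem_cell_mul hx
    obtain ⟨a, ha, hzy⟩ := h u z hz y hy
    rw [mul_assoc p]
    rcases letter_mul_mem hs hp hzy with h1 | h1
    · exact ⟨a, .inl ha, h1⟩
    · exact ⟨s * a, .inr ⟨a, ha, rfl⟩, by rwa [mul_assoc]⟩

/-- Virtual containment of a conjugate of `P_J` in `P_J'` descends to the Weyl group. -/
theorem closure_relIndex_conj_ne_zero {J J' : Set P.Weyl} (hJ : J ⊆ P.S) (hJ' : J' ⊆ P.S)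
    (n : P.N) (h : (P.parabolic J' hJ').relIndex (MulAut.conj (n : G) • P.parabolic J hJ) ≠ 0) :
    (Subgroup.closure J').relIndex (MulAut.conj (n : P.Weyl) • Subgroup.closure J) ≠ 0 := by
  obtain ⟨E, hE, hc⟩ := relIndex_ne_zero_iff_exists_cover.1 h
  choose c hcell using fun g : G => P.exists_mem_cell g
  choose F hF hmul using fun w : P.Weyl => exists_finite_forall_mul_mem_cell w
  refine relIndex_ne_zero_iff_exists_cover.2
    ⟨⋃ e ∈ E, F (c e), hE.biUnion fun e _ => hF _, fun w hw => ?_⟩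
  obtain ⟨m, rfl⟩ := QuotientGroup.mk_surjective w
  rw [SetLike.mem_coe, mem_conj_smul] at hw
  have hm : (m : G) ∈ MulAut.conj (n : G) • P.parabolic J hJ :=
    mem_conj_smul.2 (cell_subset_parabolic hJ hw (coe_mem_cell (n⁻¹ * m * n)))
  obtain ⟨e, he, p, ⟨u, hu, hp⟩, hep⟩ := Set.mem_mul.1 (hc hm)
  obtain ⟨a, ha, hau⟩ := hmul (c e) u e (hcell e) p hp
  have hep' : e * p = m := hep
  rw [hep'] at hau
  exact Set.mem_mul.2 ⟨a, Set.mem_biUnion he ha, u, hu, eq_of_mem_cell hau (coe_mem_cell m)⟩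

/-! ### Conjugates of a parabolic subgroup inside its commensurability class -/

theorem conj_parabolic_relIndex_ne_zero_of_mem_perp (hB : IsCommensurated P.B) {I : Set P.Weyl}
    (hI : I ⊆ P.S) {t : P.Weyl} (ht : t ∈ perp P.S I) {g : G} (hg : g ∈ P.cell t) :
    (MulAut.conj g • P.parabolic I hI).relIndex (P.parabolic I hI) ≠ 0 := by
  -- The cells met by `P_I g` are of the form `B w B` or `B w t B = B t w B` with `w ∈ ⟨I⟩`.
  obtain ⟨E, hE, hc⟩ := exists_cover_of_forall_mem_cell hB hI (F := {1, t})
    (A := (P.parabolic I hI : Set G) * {g}) (Set.toFinite _) (by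
      rintro _ ⟨x, ⟨w, hw, hx⟩, _, rfl, rfl⟩
      rcases mul_letter_mem ht.1 hx hg with h | h
      · exact ⟨1, by simp, w, hw, by simpa using h⟩
      · refine ⟨t, by simp, w, hw, ?_⟩
        rwa [commute_of_mem_closure_perp (Subgroup.subset_closure ht) hw] at h)
  refine relIndex_ne_zero_iff_exists_cover.2 ⟨E * {g⁻¹}, hE.mul (Set.finite_singleton _),
    fun x hx => ?_⟩
  obtain ⟨e, he, p, hp, hep⟩ := Set.mem_mul.1 (hc (Set.mul_mem_mul hx (Set.mem_singleton g)))
  refine Set.mem_mul.2 ⟨e * g⁻¹, Set.mul_mem_mul he rfl, g * p * g⁻¹, ?_, ?_⟩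
  · rw [SetLike.mem_coe, mem_conj_smul]
    simpa [mul_assoc] using hp
  · have : e * g⁻¹ * (g * p * g⁻¹) = e * p * g⁻¹ := by group
    rw [this, hep, mul_inv_cancel_right]

theorem conj_parabolic_relIndex_ne_zero_of_mem_closure_perp (hB : IsCommensurated P.B)
    {I : Set P.Weyl} (hI : I ⊆ P.S) {w : P.Weyl} (hw : w ∈ Subgroup.closure (perp P.S I)) :
    ∀ g ∈ P.cell w, (MulAut.conj g • P.parabolic I hI).relIndex (P.parabolic I hI) ≠ 0 := by
  refine closure_induction_of_involutions (fun s hs => P.mul_self s hs.1) ?_ ?_ hw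
  · intro g hg
    rw [Subgroup.conj_smul_eq_self_of_mem (B_le_parabolic hI (mem_cell_one.1 hg))]
    simp
  · intro t ht w _ ih g hg
    obtain ⟨x, hx, y, hy, rfl⟩ := exists_mul_of_mem_cell_mul hg
    refine Subgroup.relIndex_ne_zero_trans (K := MulAut.conj x • P.parabolic I hI) ?_
      (conj_parabolic_relIndex_ne_zero_of_mem_perp hB hI ht hx)
    rw [map_mul, mul_smul, Subgroup.relIndex_pointwise_smul]
    exact ih y hy

/-- If `I` is essential, then `P_I` is commensurate with every conjugate of `P_I` that it
virtually contains. -/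
theorem conj_parabolic_relIndex_ne_zero (hB : IsCommensurated P.B) {I : Set P.Weyl}
    (hI : I ⊆ P.S) (hess : IsEssential I) (n : P.N)
    (h : (P.parabolic I hI).relIndex (MulAut.conj (n : G) • P.parabolic I hI) ≠ 0) :
    (MulAut.conj (n : G) • P.parabolic I hI).relIndex (P.parabolic I hI) ≠ 0 := by
  have hW := closure_relIndex_conj_ne_zero hI hI n h
  rw [relIndex_conj_smul_right] at hW
  obtain ⟨-, x, hx, d, hd, y, hy, hxy⟩ :=
    P.hasExchange.subset_of_relIndex_conj_ne_zero hI hI hess hW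
  have hn : (n : G) ∈ P.cell (y⁻¹ * (d⁻¹ * x⁻¹)) := by
    have : (n : P.Weyl) = y⁻¹ * (d⁻¹ * x⁻¹) := by
      rw [← inv_inj, hxy]; group
    rw [← this]
    exact coe_mem_cell n
  obtain ⟨a, ha, q, hq, hab⟩ := exists_mul_of_mem_cell_mul hn
  obtain ⟨b, hb, c, hc, rfl⟩ := exists_mul_of_mem_cell_mul hq
  have ha' := cell_subset_parabolic hI (inv_mem hy) ha
  have hc' := cell_subset_parabolic hI (inv_mem hx) hc
  have := conj_parabolic_relIndex_ne_zero_of_mem_closure_perp hB hI (inv_mem hd) b hb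
  rw [hab, map_mul, map_mul, mul_smul, mul_smul, Subgroup.conj_smul_eq_self_of_mem hc']
  rwa [← Subgroup.relIndex_pointwise_smul (MulAut.conj a),
    Subgroup.conj_smul_eq_self_of_mem ha'] at this

/-- The conjugating element disappears on passing to the Weyl group: `⟨J⟩` is virtually an
essential `⟨I⟩`, and `I ⊆ J'`. -/
theorem closure_relIndex_ne_zero_of_conj (hfin : P.S.Finite) {J J' : Set P.Weyl} (hJ : J ⊆ P.S)
    (hJ' : J' ⊆ P.S) (n : P.N)
    (h : (P.parabolic J' hJ').relIndex (MulAut.conj (n : G) • P.parabolic J hJ) ≠ 0) :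
    (Subgroup.closure J').relIndex (Subgroup.closure J) ≠ 0 := by
  obtain ⟨I, hIJ, hess, hI⟩ := exists_isEssential (hfin.subset hJ)
  have hW := closure_relIndex_conj_ne_zero hJ hJ' n h
  rw [relIndex_conj_smul_right] at hW
  obtain ⟨hsub, -⟩ := P.hasExchange.subset_of_relIndex_conj_ne_zero (hIJ.trans hJ) hJ' hess
    (fun h0 => hW (Subgroup.relIndex_eq_zero_of_le_right (Subgroup.closure_mono hIJ) h0))
  exact fun h0 => hI (Subgroup.relIndex_eq_zero_of_le_left (Subgroup.closure_mono hsub) h0)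

/-- The case of two commensurable parabolic subgroups reduces to that of a single `P_I` with `I`
essential, since `P_J`, `P_J'` and `P_I` are all commensurate. -/
theorem conj_parabolic_relIndex_ne_zero_of_commensurable (hB : IsCommensurated P.B)
    (hfin : P.S.Finite) {J J' : Set P.Weyl} (hJ : J ⊆ P.S) (hJ' : J' ⊆ P.S) (n : P.N)
    (hc : (Subgroup.closure J).Commensurable (Subgroup.closure J'))
    (h : (P.parabolic J' hJ').relIndex (MulAut.conj (n : G) • P.parabolic J hJ) ≠ 0) :
    (MulAut.conj (n : G) • P.parabolic J hJ).relIndex (P.parabolic J' hJ') ≠ 0 := by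
  obtain ⟨I, hIJ, hess, hI⟩ := exists_isEssential (hfin.subset hJ)
  have hIS := hIJ.trans hJ
  have hcI : (Subgroup.closure I).Commensurable (Subgroup.closure J') :=
    Subgroup.Commensurable.trans ⟨hI, by
      rw [Subgroup.relIndex_eq_one.2 (Subgroup.closure_mono hIJ)]; simp⟩ hc
  have h1 : (P.parabolic I hIS).relIndex (P.parabolic J hJ) ≠ 0 :=
    parabolic_relIndex_ne_zero hB hJ hIS hI
  have h2 : (P.parabolic J hJ).relIndex (P.parabolic I hIS) ≠ 0 :=
    parabolic_relIndex_ne_zero hB hIS hJ (hcI.trans hc.symm).2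
  have h3 : (P.parabolic I hIS).relIndex (P.parabolic J' hJ') ≠ 0 :=
    parabolic_relIndex_ne_zero hB hJ' hIS hcI.1
  have h4 := conj_parabolic_relIndex_ne_zero hB hIS hess n <|
    Subgroup.relIndex_ne_zero_trans h3 <| Subgroup.relIndex_ne_zero_trans h <| by
      rwa [Subgroup.relIndex_pointwise_smul]
  refine Subgroup.relIndex_ne_zero_trans ?_ (Subgroup.relIndex_ne_zero_trans h4 h3)
  rwa [Subgroup.relIndex_pointwise_smul]

end BNPair

end BNPairs

/-! ### Virtual containment up to conjugation -/

theorem mainTheorem8 {G : Type*} [Group G] (P : BNPairs.BNPair G) (hS : P.S.Finite)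
    (hB : BNPairs.IsCommensurated P.B) (J J' : Set P.Weyl) (hJ : J ⊆ P.S) (hJ' : J' ⊆ P.S) :
    (∀ g : G,
      BNPairs.VirtuallyContains (P.parabolic J' hJ') (MulAut.conj g • P.parabolic J hJ) →
        BNPairs.parabolicClass hJ ≤ BNPairs.parabolicClass hJ' ∧
        (BNPairs.parabolicClass hJ = BNPairs.parabolicClass hJ' ↔
          (MulAut.conj g • P.parabolic J hJ).Commensurable (P.parabolic J' hJ'))) ∧
    (BNPairs.parabolicClass hJ ≤ BNPairs.parabolicClass hJ' →
      BNPairs.VirtuallyContains (P.parabolic J' hJ') (P.parabolic J hJ)) := by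
  open BNPairs BNPairs.BNPair in
  simp only [le_antisymm_iff, parabolicClass_le_iff, virtuallyContains_iff]
  refine ⟨fun g hg => ?_, parabolic_relIndex_ne_zero hB hJ hJ'⟩
  obtain ⟨w, b, hb, n, -, b', hb', rfl⟩ := P.exists_mem_cell g
  -- The factors `b` and `b'` of `g = b n b'` normalize both parabolic subgroups.
  have hbJ' := Subgroup.conj_smul_eq_self_of_mem (B_le_parabolic hJ' hb)
  have hb'J := Subgroup.conj_smul_eq_self_of_mem (B_le_parabolic hJ hb')
  have hconj : MulAut.conj (b * n * b') • P.parabolic J hJ =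
      MulAut.conj b • MulAut.conj (n : G) • P.parabolic J hJ := by
    rw [map_mul, map_mul, mul_smul, mul_smul, hb'J]
  have e1 : (P.parabolic J' hJ').relIndex (MulAut.conj (b * n * b') • P.parabolic J hJ) =
      (P.parabolic J' hJ').relIndex (MulAut.conj (n : G) • P.parabolic J hJ) := by
    conv_lhs => rw [hconj, ← hbJ']
    exact Subgroup.relIndex_pointwise_smul _ _ _
  have e2 : (MulAut.conj (b * n * b') • P.parabolic J hJ).relIndex (P.parabolic J' hJ') =
      (MulAut.conj (n : G) • P.parabolic J hJ).relIndex (P.parabolic J' hJ') := by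
    conv_lhs => rw [hconj, ← hbJ']
    exact Subgroup.relIndex_pointwise_smul _ _ _
  rw [Subgroup.Commensurable, e1, e2]
  rw [e1] at hg
  have hle := closure_relIndex_ne_zero_of_conj hS hJ hJ' n hg
  refine ⟨hle, fun h => ⟨?_, hg⟩, fun h => ⟨hle, ?_⟩⟩
  · exact conj_parabolic_relIndex_ne_zero_of_commensurable hB hS hJ hJ' n ⟨h.2, h.1⟩ hg
  · refine closure_relIndex_ne_zero_of_conj hS hJ' hJ n⁻¹ ?_
    rw [relIndex_conj_smul_right]
    simpa using h.1
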